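/- **Theorem.** Let $\beta>3$, $w_0>0$ and $\lambda>0$ be constants. For $n,d\in\mathbb N$ with $d\ge 1$, let $G=\mathrm{GIRG}(n,\beta,w_0,d)$ be the standard geometric inhomogeneous random graph: each of the $n$ vertices $v$ independently receives a weight $w_v$ with the Pareto law $\Pr[w_v\le x]=1-(x/w_0)^{1-\beta}$ for $x\ge w_0$ and, independently of the weights, an independent uniformly distributed position $\mathbf x_v$ in the torus $\mathbb T^d=(\mathbb R/\mathbb Z)^d$; two distinct vertices $u,v$ are adjacent if and only if $$\max_{1\le i\le d}|\mathbf x_{ui}-\mathbf x_{vi}|_C\;\le\; \frac12\left(\frac{\lambda w_uw_v}{n}\right)^{1/d},$$ where $|\cdot|_C$ denotes the distance on the circle of length $1$. Let $\omega(G)$ be the clique number of $G$. There is a constant $C>0$, depending only on $\beta$, $w_0$ and $\lambda$, such that for every function $d=d(n)\ge 1$ with $d(n)=o(\log n)$, $$\Pr\left[\omega(G)\le C\,\frac{\log n}{d(n)+\log\log n}\right]\longrightarrow 1\qquad (n\to\infty),$$ that is, $\omega(G)=O\left(\log n/(d+\log\log n)\right)$ asymptotically almost surely. -/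

import Mathlib

open MeasureTheory ProbabilityTheory Filter Topology Asymptotics

noncomputable section

namespace GIRG

/-- Outcomes of the random experiment: a weight and a position in the `d`-dimensional torus
`(ℝ/ℤ)^d` for each of the `n` vertices. -/
abbrev Sample (n d : ℕ) : Type := (Fin n → ℝ) × (Fin n → UnitAddTorus (Fin d))

/-- The law of the experiment: all weights and positions are independent, each weight is Pareto
distributed with `P(w ≤ x) = 1 - (x / w₀) ^ (1 - β)` for `x ≥ w₀` (scale `w₀`, shape `β - 1`), and
each position is uniform on the torus. -/
def law (n d : ℕ) (β w₀ : ℝ) : Measure (Sample n d) :=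
  (Measure.pi fun _ : Fin n => paretoMeasure w₀ (β - 1)).prod
    (Measure.pi fun _ : Fin n => (volume : Measure (UnitAddTorus (Fin d))))

/-- The connection threshold `(1 / 2) (lam * a * b / n) ^ (1 / d)` of two vertices of weights
`a` and `b`. -/
def threshold (n d : ℕ) (lam a b : ℝ) : ℝ :=
  (1 / 2) * (lam * a * b / n) ^ (1 / (d : ℝ))

/-- The standard geometric inhomogeneous random graph: distinct vertices are adjacent if and only
if their distance is at most their threshold. Here `dist` on `Fin d → ℝ/ℤ` is the maximum over the
coordinates of the distance on the circle of length `1`. -/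
def graph {n d : ℕ} (lam : ℝ) (s : Sample n d) : SimpleGraph (Fin n) where
  Adj u v := u ≠ v ∧ dist (s.2 u) (s.2 v) ≤ threshold n d lam (s.1 u) (s.1 v)
  symm := ⟨fun u v h => ⟨h.1.symm, by
    have h2 := h.2
    rw [dist_comm, threshold, mul_right_comm] at h2
    exact h2⟩⟩
  loopless := ⟨fun _ h => h.1 rfl⟩

end GIRG

end

/-! Let `v` be the lightest vertex of a clique, of weight `w`, and call a member of the clique heavy
if its weight is at least `(11 / 10) ^ d * w`. By the Pareto tail, a given vertex is a heavy
neighbour of `v` with probability `O((10 / 11) ^ d / n)`. The other members are pairwise within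
distance `R`, which is `(11 / 10) ^ 2` times the threshold of two vertices of weight `w`. Hence, if
`R ≤ 1 / 4`, their positions relative to `v` lie, in each coordinate, in `[-R / 2, R]` or in
`[-R, R / 2]`, so they all lie in one of `2 ^ d` boxes of side `3 * R / 2`; since
`3 / 4 * (11 / 10) ^ 2 ≤ 10 / 11`, a given vertex heavier than `v` lies in a given box with
probability `O((10 / 11) ^ d / n)` as well. If `R > 1 / 4`, then `w` is of order at least
`n ^ (1 / 2) * 4 ^ (-d / 2)`, and as `β > 3` being heavier than `v` already is unlikely enough.

A union bound over `v`, the box and `k` further members gives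
`P(k < ω(G)) ≤ n * 2 ^ d * (A * (10 / 11) ^ d) ^ k / k!`, which is at most `1 / n` for `k` of order
`log n / (d + log log n)`. -/

namespace GIRG

open scoped ENNReal

section Torus

lemma exists_coe_eq_and_abs_eq_norm {p : ℝ} (x : AddCircle p) :
    ∃ t : ℝ, (t : AddCircle p) = x ∧ |t| = ‖x‖ := by
  induction x using QuotientAddGroup.induction_on with
  | H y =>
    refine ⟨y - round (p⁻¹ * y) * p, ?_, (AddCircle.norm_eq p).symm⟩
    rw [AddCircle.coe_sub, sub_eq_self]
    exact (AddCircle.coe_eq_zero_iff p).2 ⟨round (p⁻¹ * y), zsmul_eq_mul _ _⟩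

/-- Since `R` is at most a quarter of the period, distances in `A` are those of real lifts relative
to `x`; the lifts lie in `[-R / 2, R]` or in `[-R, R / 2]`. -/
lemma exists_sign_forall_dist_le {p : ℝ} (hp : p ≠ 0) {A : Set (AddCircle p)} {x : AddCircle p}
    {R : ℝ} (hR : R ≤ |p| / 4) (hx : x ∈ A) (hA : ∀ a ∈ A, ∀ b ∈ A, dist a b ≤ R) :
    ∃ ε : ℤˣ, ∀ a ∈ A, dist a (x + (((ε : ℤ) * (R / 4) : ℝ) : AddCircle p)) ≤ 3 / 4 * R := by
  choose t ht_coe ht_abs using exists_coe_eq_and_abs_eq_norm (p := p)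
  have lift_le : ∀ a ∈ A, |t (a - x)| ≤ R := fun a ha => by
    rw [ht_abs, ← dist_eq_norm]
    exact hA a ha x hx
  have lift_sub_le : ∀ a ∈ A, ∀ b ∈ A, |t (a - x) - t (b - x)| ≤ R := fun a ha b hb => by
    have hsmall : |t (a - x) - t (b - x)| ≤ |p| / 2 :=
      (abs_sub _ _).trans (by linarith [lift_le a ha, lift_le b hb])
    rw [← (AddCircle.norm_coe_eq_abs_iff p hp).2 hsmall, AddCircle.coe_sub, ht_coe, ht_coe,
      sub_sub_sub_cancel_right, ← dist_eq_norm]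
    exact hA a ha b hb
  have dist_le_lift : ∀ a (c : ℝ), dist a (x + (c : AddCircle p)) ≤ |t (a - x) - c| :=
    fun a c => by
    have hlift : a - (x + (c : AddCircle p)) = ((t (a - x) - c : ℝ) : AddCircle p) := by
      rw [AddCircle.coe_sub, ht_coe, sub_sub]
    rw [dist_eq_norm, hlift]
    exact QuotientAddGroup.norm_mk_le_norm
  by_cases hleft : ∀ a ∈ A, -(R / 2) ≤ t (a - x)
  · refine ⟨1, fun a ha => (dist_le_lift a _).trans (abs_le.2 ?_)⟩
    have := abs_le.1 (lift_le a ha)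
    have := hleft a ha
    push_cast
    constructor <;> linarith
  · push Not at hleft
    obtain ⟨b, hb, hbt⟩ := hleft
    refine ⟨-1, fun a ha => (dist_le_lift a _).trans (abs_le.2 ?_)⟩
    have := abs_le.1 (lift_le a ha)
    have := abs_le.1 (lift_sub_le a ha b hb)
    push_cast
    constructor <;> linarith

/-- The point of the torus with coordinates `± R / 4`, with signs `ε`: the centre, relative to the
lightest vertex, of one of the boxes that can contain the light vertices of a clique. -/
noncomputable def shift {ι : Type*} (ε : ι → ℤˣ) (R : ℝ) : UnitAddTorus ι :=
  fun i => (((ε i : ℤ) * (R / 4) : ℝ) : UnitAddCircle)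

@[fun_prop]
lemma measurable_shift {ι : Type*} (ε : ι → ℤˣ) : Measurable (shift ε) :=
  measurable_pi_lambda _ fun _ => AddCircle.measurable_mk'.comp (by fun_prop)

variable {ι : Type*} [Fintype ι]

lemma exists_signs_forall_dist_le {A : Set (UnitAddTorus ι)} {x : UnitAddTorus ι} {R : ℝ}
    (hR : R ≤ 1 / 4) (hx : x ∈ A) (hA : ∀ a ∈ A, ∀ b ∈ A, dist a b ≤ R) :
    ∃ ε : ι → ℤˣ, ∀ a ∈ A, dist a (x + shift ε R) ≤ 3 / 4 * R := by
  have hR₀ : 0 ≤ R := dist_nonneg.trans (hA x hx x hx)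
  have hcoord (i : ι) : ∃ ε : ℤˣ, ∀ a ∈ (fun y => y i) '' A,
      dist a (x i + (((ε : ℤ) * (R / 4) : ℝ) : UnitAddCircle)) ≤ 3 / 4 * R := by
    refine exists_sign_forall_dist_le one_ne_zero (by rwa [abs_one]) ⟨x, hx, rfl⟩ ?_
    rintro _ ⟨a, ha, rfl⟩ _ ⟨b, hb, rfl⟩
    exact (dist_le_pi_dist a b i).trans (hA a ha b hb)
  choose ε hε using hcoord
  exact ⟨ε, fun a ha => (dist_pi_le_iff (by positivity)).2 fun i => hε i _ ⟨a, ha, rfl⟩⟩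

instance isProbabilityMeasure_volume_unitAddTorus :
    IsProbabilityMeasure (volume : Measure (UnitAddTorus ι)) where
  measure_univ := by
    rw [volume_pi, Measure.pi_univ]
    exact Finset.prod_eq_one fun _ _ => UnitAddCircle.measure_univ

lemma volume_closedBall_unitAddTorus_le (c : UnitAddTorus ι) {r : ℝ} (hr : 0 ≤ r) :
    volume (Metric.closedBall c r) ≤ ENNReal.ofReal ((2 * r) ^ Fintype.card ι) := by
  rw [volume_pi_closedBall c hr, ENNReal.ofReal_pow (by positivity), ← Finset.card_univ,
    ← Finset.prod_const]
  refine Finset.prod_le_prod' fun i _ => ?_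
  rw [AddCircle.volume_closedBall]
  exact ENNReal.ofReal_le_ofReal (min_le_right _ _)

end Torus

section Pareto

variable {t r a : ℝ}

lemma setLIntegral_Ici_rpow_paretoMeasure {p : ℝ} (ht : 0 < t) (hr : 0 < r) (hp : p < r)
    (ha : t ≤ a) :
    ∫⁻ x in Set.Ici a, ENNReal.ofReal (x ^ p) ∂paretoMeasure t r
      = ENNReal.ofReal (r / (r - p) * t ^ r * a ^ (p - r)) := by
  have ha₀ : 0 < a := ht.trans_le ha
  have hpdf : Measurable (paretoPDF t r) := (measurable_paretoPDFReal t r).ennreal_ofReal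
  have hdensity : ∀ x ∈ Set.Ici a, (paretoPDF t r * fun x => ENNReal.ofReal (x ^ p)) x
      = ENNReal.ofReal (r * t ^ r * x ^ (p - r - 1)) := fun x hx => by
    have hx₀ : 0 < x := ha₀.trans_le hx
    rw [Pi.mul_apply, paretoPDF_of_le (ha.trans hx), ← ENNReal.ofReal_mul (by positivity),
      mul_assoc, ← Real.rpow_add hx₀, neg_add_eq_sub, sub_add_eq_sub_sub]
  rw [paretoMeasure, restrict_withDensity measurableSet_Ici,
    lintegral_withDensity_eq_lintegral_mul _ hpdf (by fun_prop),
    setLIntegral_congr_fun measurableSet_Ici hdensity, setLIntegral_congr Ioi_ae_eq_Ici.symm,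
    ← ofReal_integral_eq_lintegral_ofReal]
  · have hrp : r - p ≠ 0 := by linarith
    rw [integral_const_mul, integral_Ioi_rpow_of_lt (by linarith) ha₀, sub_add_cancel,
      ← neg_sub r p, neg_div_neg_eq]
    congr 1
    field_simp
  · exact (integrableOn_Ioi_rpow_of_lt (by linarith) ha₀).const_mul _
  · refine (ae_restrict_iff' measurableSet_Ioi).2 (ae_of_all _ fun x hx => ?_)
    have hx₀ : 0 < x := ha₀.trans hx
    rw [Pi.zero_apply]
    positivity

lemma paretoMeasure_Ici (ht : 0 < t) (hr : 0 < r) (ha : t ≤ a) :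
    paretoMeasure t r (Set.Ici a) = ENNReal.ofReal ((t / a) ^ r) := by
  have ha₀ : 0 < a := ht.trans_le ha
  have h := setLIntegral_Ici_rpow_paretoMeasure ht hr hr ha
  simp only [Real.rpow_zero, ENNReal.ofReal_one, setLIntegral_one] at h
  rw [h, Real.div_rpow ht.le ha₀.le, sub_zero, div_self hr.ne', one_mul, zero_sub,
    Real.rpow_neg ha₀.le, div_eq_mul_inv]

lemma div_rpow_le_sq (ht : 0 < t) (hr : 2 ≤ r) (ha : t ≤ a) : (t / a) ^ r ≤ (t / a) ^ 2 := by
  have ha₀ : 0 < a := ht.trans_le ha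
  rw [← Real.rpow_two]
  exact Real.rpow_le_rpow_of_exponent_ge (by positivity) ((div_le_one ha₀).2 ha) hr

lemma paretoMeasure_Ici_le_sq (ht : 0 < t) (hr : 2 ≤ r) (ha : t ≤ a) :
    paretoMeasure t r (Set.Ici a) ≤ ENNReal.ofReal ((t / a) ^ 2) := by
  rw [paretoMeasure_Ici ht (by linarith) ha]
  exact ENNReal.ofReal_le_ofReal (div_rpow_le_sq ht hr ha)

lemma setLIntegral_Ici_paretoMeasure_le (ht : 0 < t) (hr : 2 ≤ r) (ha : t ≤ a) :
    ∫⁻ x in Set.Ici a, ENNReal.ofReal x ∂paretoMeasure t r ≤ ENNReal.ofReal (2 * t ^ 2 / a) := by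
  have ha₀ : 0 < a := ht.trans_le ha
  have h := setLIntegral_Ici_rpow_paretoMeasure (r := r) (p := 1) ht (by linarith)
    (by linarith) ha
  simp only [Real.rpow_one] at h
  rw [h]
  refine ENNReal.ofReal_le_ofReal ?_
  have hratio : r / (r - 1) ≤ 2 := by
    rw [div_le_iff₀ (by linarith)]
    linarith
  calc r / (r - 1) * t ^ r * a ^ (1 - r) = r / (r - 1) * (t / a) ^ r * a := by
        rw [Real.div_rpow ht.le ha₀.le, Real.rpow_sub ha₀, Real.rpow_one]
        ring
    _ ≤ 2 * (t / a) ^ 2 * a := by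
        gcongr
        exact div_rpow_le_sq ht hr ha
    _ = 2 * t ^ 2 / a := by field_simp

lemma ae_le_paretoMeasure : ∀ᵐ x ∂paretoMeasure t r, t ≤ x := by
  simp only [ae_iff, not_le]
  exact (withDensity_apply _ measurableSet_Iio).trans (lintegral_paretoPDF_of_le le_rfl)

end Pareto

section UnionBound

variable {α : Type*} [MeasurableSpace α] {ν : Measure α} [IsProbabilityMeasure ν]
  {T : α → Set α} {q : ℝ≥0∞}

lemma measure_pi_forall_mem_le_pow {n : ℕ} {v : Fin n} {S : Finset (Fin n)} (hv : v ∉ S)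
    (hT : MeasurableSet {p : α × α | p.2 ∈ T p.1}) (hq : ∀ᵐ z ∂ν, ν (T z) ≤ q) :
    Measure.pi (fun _ : Fin n => ν) {ω | ∀ u ∈ S, ω u ∈ T (ω v)} ≤ q ^ S.card := by
  obtain _ | m := n
  · exact v.elim0
  obtain ⟨S, -, rfl⟩ : ∃ S' ⊆ Finset.univ, S = S'.map v.succAboveEmb :=
    Finset.subset_map_iff.1 fun u hu => by
      simpa using Fin.exists_succAbove_eq (ne_of_mem_of_not_mem hu hv)
  let E : Set (α × (Fin m → α)) := {p | ∀ u ∈ S, p.2 u ∈ T p.1}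
  have hE : MeasurableSet E := by
    have hE_eq : E = ⋂ u ∈ S, (fun p => (p.1, p.2 u)) ⁻¹' {p : α × α | p.2 ∈ T p.1} := by
      ext p
      simp [E]
    rw [hE_eq]
    exact Finset.measurableSet_biInter S fun u _ => hT.preimage (by fun_prop)
  have hpre : {ω : Fin (m + 1) → α | ∀ u ∈ S.map v.succAboveEmb, ω u ∈ T (ω v)}
      = MeasurableEquiv.piFinSuccAbove (fun _ => α) v ⁻¹' E := by
    ext ω
    simp [E, Fin.removeNth]
  rw [hpre, (measurePreserving_piFinSuccAbove (fun _ => ν) v).measure_preimage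
    hE.nullMeasurableSet, Measure.prod_apply hE, Finset.card_map]
  calc ∫⁻ z, Measure.pi (fun _ : Fin m => ν) (Prod.mk z ⁻¹' E) ∂ν
      ≤ ∫⁻ _, q ^ S.card ∂ν := by
        refine lintegral_mono_ae (hq.mono fun z hz => ?_)
        have hfiber : Measure.pi (fun _ => ν) (Prod.mk z ⁻¹' E) = ν (T z) ^ S.card :=
          (Measure.pi_pi_finset (fun _ => ν) (fun _ => T z) S).trans (Finset.prod_const _)
        rw [hfiber]
        gcongr
    _ = q ^ S.card := by rw [lintegral_const, measure_univ, mul_one]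

lemma measure_pi_exists_card_eq_le (n k : ℕ) (hT : MeasurableSet {p : α × α | p.2 ∈ T p.1})
    (hq : ∀ᵐ z ∂ν, ν (T z) ≤ q) :
    Measure.pi (fun _ : Fin n => ν)
      {ω | ∃ v, ∃ S : Finset (Fin n), S.card = k ∧ v ∉ S ∧ ∀ u ∈ S, ω u ∈ T (ω v)}
      ≤ n * (n.choose k * q ^ k) := by
  let stars (v : Fin n) : Finset (Finset (Fin n)) := (Finset.univ.erase v).powersetCard k
  calc _ ≤ Measure.pi (fun _ => ν) (⋃ v, ⋃ S ∈ stars v, {ω | ∀ u ∈ S, ω u ∈ T (ω v)}) := by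
        refine measure_mono ?_
        rintro ω ⟨v, S, hS, hv, h⟩
        have hmem : S ∈ stars v := Finset.mem_powersetCard.2
          ⟨Finset.subset_erase.2 ⟨Finset.subset_univ S, hv⟩, hS⟩
        exact Set.mem_iUnion.2 ⟨v, Set.mem_biUnion hmem h⟩
    _ ≤ ∑ v, ∑ _S ∈ stars v, q ^ k := by
        refine (measure_iUnion_fintype_le _ _).trans (Finset.sum_le_sum fun v _ => ?_)
        refine (measure_biUnion_finset_le _ _).trans (Finset.sum_le_sum fun S hS => ?_)
        obtain ⟨hSv, rfl⟩ := Finset.mem_powersetCard.1 hS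
        exact measure_pi_forall_mem_le_pow (Finset.subset_erase.1 hSv).2 hT hq
    _ = n * ((n - 1).choose k * q ^ k) := by simp [stars]
    _ ≤ n * (n.choose k * q ^ k) := by
        gcongr
        exact n.sub_le 1

end UnionBound

section Confinement

/-- The weight and the position of a vertex. -/
abbrev Mark (d : ℕ) : Type := ℝ × UnitAddTorus (Fin d)

variable {n d : ℕ} {lam a b a' b' w : ℝ}

@[fun_prop]
lemma measurable_threshold {α : Type*} [MeasurableSpace α] {f g : α → ℝ} (hf : Measurable f)
    (hg : Measurable g) : Measurable fun x => threshold n d lam (f x) (g x) := by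
  unfold threshold
  fun_prop

lemma threshold_nonneg (hlam : 0 ≤ lam) (ha : 0 ≤ a) (hb : 0 ≤ b) :
    0 ≤ threshold n d lam a b := by
  unfold threshold
  positivity

lemma threshold_mono (hlam : 0 ≤ lam) (ha : 0 ≤ a) (hb : 0 ≤ b) (haa' : a ≤ a') (hbb' : b ≤ b') :
    threshold n d lam a b ≤ threshold n d lam a' b' := by
  have ha' : 0 ≤ a' := ha.trans haa'
  unfold threshold
  gcongr

lemma two_mul_threshold_pow (hd : d ≠ 0) (hlam : 0 ≤ lam) (ha : 0 ≤ a) (hb : 0 ≤ b) :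
    (2 * threshold n d lam a b) ^ d = lam * a * b / n := by
  rw [threshold, ← mul_assoc, mul_one_div_cancel two_ne_zero, one_mul, one_div,
    Real.rpow_inv_natCast_pow (by positivity) hd]

lemma threshold_pow_mul_pow_mul (hd : d ≠ 0) (hlam : 0 ≤ lam) (ha : 0 ≤ a) (hb : 0 ≤ b)
    (c : ℝ) :
    threshold n d lam (c ^ d * a) (c ^ d * b) = c ^ 2 * threshold n d lam a b := by
  have hscale : lam * (c ^ d * a) * (c ^ d * b) / n = (c ^ 2) ^ d * (lam * a * b / n) := by ring
  rw [threshold, threshold, hscale, Real.mul_rpow (by positivity) (by positivity), one_div (d : ℝ),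
    Real.pow_rpow_inv_natCast (by positivity) hd]
  ring

lemma volume_closedBall_mul_threshold_le (hd : d ≠ 0) (hlam : 0 ≤ lam) (ha : 0 ≤ a) (hb : 0 ≤ b)
    {c : ℝ} (hc : 0 ≤ c) (x : UnitAddTorus (Fin d)) :
    volume (Metric.closedBall x (c * threshold n d lam a b))
      ≤ ENNReal.ofReal (c ^ d * (lam * a * b / n)) := by
  have hr : 0 ≤ c * threshold n d lam a b := mul_nonneg hc (threshold_nonneg hlam ha hb)
  refine (volume_closedBall_unitAddTorus_le x hr).trans_eq ?_
  rw [Fintype.card_fin, mul_left_comm, mul_pow, two_mul_threshold_pow hd hlam ha hb]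

/-- The connection threshold of two vertices of weight `(11 / 10) ^ d * w`. It bounds the distances
in a clique between light vertices, those of weight less than `(11 / 10) ^ d * w` where `w` is the
least weight in the clique. -/
noncomputable def lightRadius (n d : ℕ) (lam w : ℝ) : ℝ :=
  threshold n d lam ((11 / 10) ^ d * w) ((11 / 10) ^ d * w)

lemma lightRadius_eq (hd : d ≠ 0) (hlam : 0 ≤ lam) (hw : 0 ≤ w) :
    lightRadius n d lam w = (11 / 10) ^ 2 * threshold n d lam w w :=
  threshold_pow_mul_pow_mul hd hlam hw hw _

@[fun_prop]
lemma measurable_lightRadius : Measurable (lightRadius n d lam) := by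
  unfold lightRadius
  fun_prop

/-- The weights and positions of heavy neighbours of a vertex `z`: those whose weight is at least
`(11 / 10) ^ d` times that of `z`. -/
def heavyRegion (n d : ℕ) (lam : ℝ) (z : Mark d) : Set (Mark d) :=
  {y | (11 / 10) ^ d * z.1 ≤ y.1 ∧ dist y.2 z.2 ≤ threshold n d lam z.1 y.1}

/-- The weights and positions of the vertices heavier than `z` in the box with signs `ε`, to which
the light vertices of a clique with lightest vertex `z` are confined for some choice of `ε`. -/
def lightRegion (n d : ℕ) (lam : ℝ) (ε : Fin d → ℤˣ) (z : Mark d) : Set (Mark d) :=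
  {y | z.1 ≤ y.1 ∧
    dist y.2 (z.2 + shift ε (lightRadius n d lam z.1)) ≤ 3 / 4 * lightRadius n d lam z.1}

/-- The region to which all other vertices of a clique with lightest vertex `z` are confined for
some choice of signs `ε`. If `z` is so heavy that its light radius exceeds `1 / 4`, only the weights
are constrained. -/
def cliqueRegion (n d : ℕ) (lam : ℝ) (ε : Fin d → ℤˣ) (z : Mark d) : Set (Mark d) :=
  {y | z.1 ≤ y.1 ∧
    (lightRadius n d lam z.1 ≤ 1 / 4 → y ∈ heavyRegion n d lam z ∪ lightRegion n d lam ε z)}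

lemma measurableSet_mem_heavyRegion :
    MeasurableSet {p : Mark d × Mark d | p.2 ∈ heavyRegion n d lam p.1} := by
  have h_weight : MeasurableSet {p : Mark d × Mark d | (11 / 10) ^ d * p.1.1 ≤ p.2.1} :=
    measurableSet_le (by fun_prop) (by fun_prop)
  have h_position : MeasurableSet {p : Mark d × Mark d |
      dist p.2.2 p.1.2 ≤ threshold n d lam p.1.1 p.2.1} :=
    measurableSet_le (by fun_prop) (by fun_prop)
  exact h_weight.inter h_position

lemma measurableSet_mem_lightRegion (ε : Fin d → ℤˣ) :
    MeasurableSet {p : Mark d × Mark d | p.2 ∈ lightRegion n d lam ε p.1} := by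
  have h_weight : MeasurableSet {p : Mark d × Mark d | p.1.1 ≤ p.2.1} :=
    measurableSet_le (by fun_prop) (by fun_prop)
  have h_position : MeasurableSet {p : Mark d × Mark d |
      dist p.2.2 (p.1.2 + shift ε (lightRadius n d lam p.1.1))
        ≤ 3 / 4 * lightRadius n d lam p.1.1} :=
    measurableSet_le (by fun_prop) (by fun_prop)
  exact h_weight.inter h_position

lemma measurableSet_mem_cliqueRegion (ε : Fin d → ℤˣ) :
    MeasurableSet {p : Mark d × Mark d | p.2 ∈ cliqueRegion n d lam ε p.1} := by
  have h_weight : MeasurableSet {p : Mark d × Mark d | p.1.1 ≤ p.2.1} :=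
    measurableSet_le (by fun_prop) (by fun_prop)
  have h_radius : MeasurableSet {p : Mark d × Mark d | lightRadius n d lam p.1.1 ≤ 1 / 4} :=
    measurableSet_le (by fun_prop) (by fun_prop)
  exact h_weight.inter (h_radius.imp
    (measurableSet_mem_heavyRegion.union (measurableSet_mem_lightRegion ε)))

variable {s : Sample n d} {Q : Finset (Fin n)} {v : Fin n}

lemma dist_le_lightRadius_of_isClique (hlam : 0 ≤ lam) (hs : ∀ u, 0 ≤ s.1 u)
    (hQ : (graph lam s).IsClique Q) {u u' : Fin n} (hu : u ∈ Q) (hu' : u' ∈ Q)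
    (huw : s.1 u ≤ (11 / 10) ^ d * w) (huw' : s.1 u' ≤ (11 / 10) ^ d * w) :
    dist (s.2 u) (s.2 u') ≤ lightRadius n d lam w := by
  have hw : 0 ≤ (11 / 10) ^ d * w := (hs u).trans huw
  obtain rfl | hne := eq_or_ne u u'
  · rw [dist_self]
    exact threshold_nonneg hlam hw hw
  · exact (hQ hu hu' hne).2.trans (threshold_mono hlam (hs u) (hs u') huw huw')

lemma exists_signs_forall_mem_cliqueRegion (hlam : 0 ≤ lam) (hs : ∀ u, 0 ≤ s.1 u)
    (hQ : (graph lam s).IsClique Q) (hv : v ∈ Q) (hv_min : ∀ u ∈ Q, s.1 v ≤ s.1 u) :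
    ∃ ε, ∀ u ∈ Q, u ≠ v → (s.1 u, s.2 u) ∈ cliqueRegion n d lam ε (s.1 v, s.2 v) := by
  by_cases hR : lightRadius n d lam (s.1 v) ≤ 1 / 4
  swap
  · exact ⟨1, fun u hu _ => ⟨hv_min u hu, fun h => absurd h hR⟩⟩
  let light : Set (Fin n) := {u | u ∈ Q ∧ s.1 u ≤ (11 / 10) ^ d * s.1 v}
  have hv_light : v ∈ light := ⟨hv, le_mul_of_one_le_left (hs v) (one_le_pow₀ (by norm_num))⟩
  obtain ⟨ε, hε⟩ := exists_signs_forall_dist_le hR (Set.mem_image_of_mem s.2 hv_light) (by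
    rintro _ ⟨u, hu, rfl⟩ _ ⟨u', hu', rfl⟩
    exact dist_le_lightRadius_of_isClique hlam hs hQ hu.1 hu'.1 hu.2 hu'.2)
  refine ⟨ε, fun u hu hne => ⟨hv_min u hu, fun _ => ?_⟩⟩
  obtain h_heavy | h_light := le_total ((11 / 10) ^ d * s.1 v) (s.1 u)
  · exact Or.inl ⟨h_heavy, dist_comm (s.2 u) (s.2 v) ▸ (hQ hv hu hne.symm).2⟩
  · exact Or.inr ⟨hv_min u hu, hε _ ⟨u, ⟨hu, h_light⟩, rfl⟩⟩

lemma exists_signs_exists_card_eq_of_lt_cliqueNum (hlam : 0 ≤ lam) (hs : ∀ u, 0 ≤ s.1 u) {k : ℕ}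
    (hk : k < (graph lam s).cliqueNum) :
    ∃ ε, ∃ v, ∃ S : Finset (Fin n), S.card = k ∧ v ∉ S ∧
      ∀ u ∈ S, (s.1 u, s.2 u) ∈ cliqueRegion n d lam ε (s.1 v, s.2 v) := by
  obtain ⟨Q, hQ⟩ := (graph lam s).exists_isNClique_cliqueNum
  have hQ_pos : 0 < Q.card := hQ.card_eq ▸ k.zero_le.trans_lt hk
  obtain ⟨v, hv, hv_min⟩ := Q.exists_min_image s.1 (Finset.card_pos.1 hQ_pos)
  obtain ⟨S, hSQ, hSk⟩ : ∃ S ⊆ Q.erase v, S.card = k := Finset.exists_subset_card_eq (by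
    rw [Finset.card_erase_of_mem hv, hQ.card_eq]
    omega)
  obtain ⟨hSQ, hvS⟩ := Finset.subset_erase.1 hSQ
  obtain ⟨ε, hε⟩ := exists_signs_forall_mem_cliqueRegion hlam hs hQ.isClique hv hv_min
  exact ⟨ε, v, S, hSk, hvS, fun u hu => hε u (hSQ hu) (ne_of_mem_of_not_mem hu hvS)⟩

end Confinement

section VertexLaw

/-- The joint law of the weight and the position of a single vertex. -/
noncomputable abbrev vertexLaw (d : ℕ) (β w₀ : ℝ) : Measure (Mark d) :=
  (paretoMeasure w₀ (β - 1)).prod volume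

variable {n d : ℕ} {β w₀ lam : ℝ}

lemma measurePreserving_arrowProdEquivProdArrow_law (hw₀ : 0 < w₀) (hβ : 1 < β) :
    MeasurePreserving (MeasurableEquiv.arrowProdEquivProdArrow ℝ (UnitAddTorus (Fin d)) (Fin n))
      (Measure.pi fun _ => vertexLaw d β w₀) (law n d β w₀) := by
  have := isProbabilityMeasure_paretoMeasure hw₀ (sub_pos.2 hβ)
  exact measurePreserving_arrowProdEquivProdArrow _ _ _ _ _

lemma isProbabilityMeasure_law (hw₀ : 0 < w₀) (hβ : 1 < β) :
    IsProbabilityMeasure (law n d β w₀) := by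
  have := isProbabilityMeasure_paretoMeasure hw₀ (sub_pos.2 hβ)
  unfold law
  infer_instance

lemma ae_vertexLaw_le_fst : ∀ᵐ z ∂vertexLaw d β w₀, w₀ ≤ z.1 :=
  Measure.quasiMeasurePreserving_fst.ae ae_le_paretoMeasure

variable {z : Mark d}

lemma volume_preimage_heavyRegion_le (hd : d ≠ 0) (hlam : 0 ≤ lam) (hz : 0 ≤ z.1) (x : ℝ) :
    volume (Prod.mk x ⁻¹' heavyRegion n d lam z)
      ≤ (Set.Ici ((11 / 10) ^ d * z.1)).indicator
        (fun x => ENNReal.ofReal (lam * z.1 / n) * ENNReal.ofReal x) x := by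
  by_cases hx : (11 / 10) ^ d * z.1 ≤ x
  · have hx₀ : 0 ≤ x := le_trans (by positivity) hx
    have hball := volume_closedBall_mul_threshold_le (n := n) hd hlam hz hx₀ zero_le_one z.2
    rw [one_pow, one_mul, one_mul] at hball
    rw [Set.indicator_of_mem (Set.mem_Ici.2 hx), ← ENNReal.ofReal_mul (by positivity),
      div_mul_eq_mul_div]
    exact (measure_mono fun y hy => hy.2).trans hball
  · have hempty : Prod.mk x ⁻¹' heavyRegion n d lam z = ∅ :=
      Set.eq_empty_of_forall_notMem fun y hy => hx hy.1
    rw [hempty, measure_empty]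
    exact zero_le

lemma vertexLaw_heavyRegion_le (hd : d ≠ 0) (hlam : 0 ≤ lam) (hw₀ : 0 < w₀) (hβ : 3 ≤ β)
    (hz : w₀ ≤ z.1) :
    vertexLaw d β w₀ (heavyRegion n d lam z)
      ≤ ENNReal.ofReal (2 * (lam * w₀ ^ 2 / n) * (10 / 11) ^ d) := by
  have := isProbabilityMeasure_paretoMeasure hw₀ (by linarith : 0 < β - 1)
  have hz₀ : 0 < z.1 := hw₀.trans_le hz
  set a := (11 / 10 : ℝ) ^ d * z.1
  have hza : z.1 ≤ a := le_mul_of_one_le_left hz₀.le (one_le_pow₀ (by norm_num))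
  have hratio : z.1 / a = (10 / 11) ^ d := by
    rw [div_mul_cancel_right₀ hz₀.ne', ← inv_pow, inv_div]
  have hmeas : MeasurableSet (heavyRegion n d lam z) :=
    measurableSet_mem_heavyRegion.preimage measurable_prodMk_left
  rw [Measure.prod_apply hmeas]
  calc _ ≤ ∫⁻ x, (Set.Ici a).indicator
          (fun x => ENNReal.ofReal (lam * z.1 / n) * ENNReal.ofReal x) x
          ∂paretoMeasure w₀ (β - 1) :=
        lintegral_mono (volume_preimage_heavyRegion_le hd hlam hz₀.le)
    _ = ENNReal.ofReal (lam * z.1 / n) *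
          ∫⁻ x in Set.Ici a, ENNReal.ofReal x ∂paretoMeasure w₀ (β - 1) := by
        rw [lintegral_indicator measurableSet_Ici, lintegral_const_mul _ (by fun_prop)]
    _ ≤ ENNReal.ofReal (lam * z.1 / n) * ENNReal.ofReal (2 * w₀ ^ 2 / a) := by
        gcongr
        exact setLIntegral_Ici_paretoMeasure_le hw₀ (by linarith) (hz.trans hza)
    _ = ENNReal.ofReal (2 * (lam * w₀ ^ 2 / n) * (10 / 11) ^ d) := by
        rw [← ENNReal.ofReal_mul (by positivity), ← hratio]
        congr 1
        ring

lemma vertexLaw_lightRegion_le (hd : d ≠ 0) (hlam : 0 ≤ lam) (hw₀ : 0 < w₀) (hβ : 3 ≤ β)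
    (ε : Fin d → ℤˣ) (hz : w₀ ≤ z.1) :
    vertexLaw d β w₀ (lightRegion n d lam ε z)
      ≤ ENNReal.ofReal (lam * w₀ ^ 2 / n * (10 / 11) ^ d) := by
  have hz₀ : 0 < z.1 := hw₀.trans_le hz
  set c : ℝ := 3 / 4 * (11 / 10) ^ 2
  have hc₀ : 0 ≤ c := by positivity
  have hc : c ≤ 10 / 11 := by norm_num [c]
  have hprod : lightRegion n d lam ε z = Set.Ici z.1 ×ˢ
      Metric.closedBall (z.2 + shift ε (lightRadius n d lam z.1))
        (c * threshold n d lam z.1 z.1) := by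
    rw [mul_assoc, ← lightRadius_eq hd hlam hz₀.le]
    rfl
  have := isProbabilityMeasure_paretoMeasure hw₀ (by linarith : 0 < β - 1)
  rw [hprod, Measure.prod_prod]
  calc _ ≤ ENNReal.ofReal ((w₀ / z.1) ^ 2) *
        ENNReal.ofReal (c ^ d * (lam * z.1 * z.1 / n)) := by
        gcongr
        · exact paretoMeasure_Ici_le_sq hw₀ (by linarith) hz
        · exact volume_closedBall_mul_threshold_le hd hlam hz₀.le hz₀.le hc₀ _
    _ = ENNReal.ofReal (lam * w₀ ^ 2 / n * c ^ d) := by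
        rw [← ENNReal.ofReal_mul (by positivity)]
        congr 1
        field_simp
    _ ≤ ENNReal.ofReal (lam * w₀ ^ 2 / n * (10 / 11) ^ d) := by gcongr

lemma div_rpow_le_of_one_fourth_lt_lightRadius (hn : n ≠ 0) (hd : d ≠ 0) (hlam : 0 ≤ lam)
    (hw₀ : 0 ≤ w₀) {w r : ℝ} (hw : 0 < w) (hr : 0 ≤ r) (hR : 1 / 4 < lightRadius n d lam w) :
    (w₀ / w) ^ r ≤ (lam * w₀ ^ 2 * 4 ^ d / n) ^ (r / 2) := by
  have hn₀ : (0 : ℝ) < n := by positivity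
  rw [lightRadius_eq hd hlam hw.le] at hR
  have hthreshold : (1 / 4 : ℝ) ≤ 2 * threshold n d lam w w := by linarith
  have hpow : (1 / 4 : ℝ) ^ d ≤ lam * w * w / n := by
    rw [← two_mul_threshold_pow hd hlam hw.le hw.le]
    gcongr
  have hsq : (w₀ / w) ^ 2 ≤ lam * w₀ ^ 2 * 4 ^ d / n := by
    calc (w₀ / w) ^ 2 = (w₀ / w) ^ 2 * 4 ^ d * (1 / 4) ^ d := by
          rw [mul_assoc, ← mul_pow, mul_one_div_cancel four_ne_zero, one_pow, mul_one]
      _ ≤ (w₀ / w) ^ 2 * 4 ^ d * (lam * w * w / n) := by gcongr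
      _ = lam * w₀ ^ 2 * 4 ^ d / n := by field_simp
  calc (w₀ / w) ^ r = ((w₀ / w) ^ 2) ^ (r / 2) := by
        rw [← Real.rpow_natCast_mul (by positivity), Nat.cast_two, mul_div_cancel₀ r two_ne_zero]
    _ ≤ (lam * w₀ ^ 2 * 4 ^ d / n) ^ (r / 2) := by gcongr

lemma vertexLaw_cliqueRegion_le (hn : n ≠ 0) (hd : d ≠ 0) (hlam : 0 ≤ lam) (hw₀ : 0 < w₀)
    (hβ : 3 ≤ β) (ε : Fin d → ℤˣ) (hz : w₀ ≤ z.1)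
    (hnd : (lam * w₀ ^ 2 * 4 ^ d / n) ^ ((β - 1) / 2) ≤ 3 * (lam * w₀ ^ 2 / n) * (10 / 11) ^ d) :
    vertexLaw d β w₀ (cliqueRegion n d lam ε z)
      ≤ ENNReal.ofReal (3 * (lam * w₀ ^ 2 / n) * (10 / 11) ^ d) := by
  by_cases hR : lightRadius n d lam z.1 ≤ 1 / 4
  · calc vertexLaw d β w₀ (cliqueRegion n d lam ε z)
        ≤ vertexLaw d β w₀ (heavyRegion n d lam z ∪ lightRegion n d lam ε z) :=
          measure_mono fun y hy => hy.2 hR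
      _ ≤ ENNReal.ofReal (2 * (lam * w₀ ^ 2 / n) * (10 / 11) ^ d) +
          ENNReal.ofReal (lam * w₀ ^ 2 / n * (10 / 11) ^ d) :=
          (measure_union_le _ _).trans (add_le_add (vertexLaw_heavyRegion_le hd hlam hw₀ hβ hz)
            (vertexLaw_lightRegion_le hd hlam hw₀ hβ ε hz))
      _ = ENNReal.ofReal (3 * (lam * w₀ ^ 2 / n) * (10 / 11) ^ d) := by
          rw [← ENNReal.ofReal_add (by positivity) (by positivity)]
          congr 1
          ring
  · have hβ₁ : 0 < β - 1 := by linarith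
    have := isProbabilityMeasure_paretoMeasure hw₀ hβ₁
    calc vertexLaw d β w₀ (cliqueRegion n d lam ε z)
        ≤ vertexLaw d β w₀ (Set.Ici z.1 ×ˢ Set.univ) :=
          measure_mono fun y hy => ⟨hy.1, Set.mem_univ _⟩
      _ = ENNReal.ofReal ((w₀ / z.1) ^ (β - 1)) := by
          rw [Measure.prod_prod, measure_univ, mul_one, paretoMeasure_Ici hw₀ hβ₁ hz]
      _ ≤ ENNReal.ofReal (3 * (lam * w₀ ^ 2 / n) * (10 / 11) ^ d) :=
          ENNReal.ofReal_le_ofReal ((div_rpow_le_of_one_fourth_lt_lightRadius hn hd hlam hw₀.le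
            (hw₀.trans_le hz) hβ₁.le (not_le.1 hR)).trans hnd)

lemma law_lt_cliqueNum_le_choose (hlam : 0 ≤ lam) (hw₀ : 0 < w₀) (hβ : 1 < β) (k : ℕ) {q : ℝ≥0∞}
    (hq : ∀ ε z, w₀ ≤ z.1 → vertexLaw d β w₀ (cliqueRegion n d lam ε z) ≤ q) :
    law n d β w₀ {s | k < (graph lam s).cliqueNum} ≤ 2 ^ d * (n * (n.choose k * q ^ k)) := by
  have := isProbabilityMeasure_paretoMeasure hw₀ (sub_pos.2 hβ)
  have hae : ∀ᵐ ω ∂Measure.pi (fun _ : Fin n => vertexLaw d β w₀), ∀ u, w₀ ≤ (ω u).1 :=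
    ae_all_iff.2 fun u =>
      (Measure.quasiMeasurePreserving_eval (fun _ => vertexLaw d β w₀) u).ae ae_vertexLaw_le_fst
  rw [← (measurePreserving_arrowProdEquivProdArrow_law hw₀ hβ).measure_preimage_equiv]
  calc _ ≤ Measure.pi (fun _ => vertexLaw d β w₀) (⋃ ε, {ω | ∃ v, ∃ S : Finset (Fin n),
        S.card = k ∧ v ∉ S ∧ ∀ u ∈ S, ω u ∈ cliqueRegion n d lam ε (ω v)}) := by
        refine measure_mono_ae (hae.mono fun ω hω hk => Set.mem_iUnion.2 ?_)
        exact exists_signs_exists_card_eq_of_lt_cliqueNum hlam (fun u => hw₀.le.trans (hω u)) hk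
    _ ≤ ∑ _ε : Fin d → ℤˣ, n * (n.choose k * q ^ k) := by
        refine (measure_iUnion_fintype_le _ _).trans (Finset.sum_le_sum fun ε _ => ?_)
        exact measure_pi_exists_card_eq_le n k (measurableSet_mem_cliqueRegion ε)
          (ae_vertexLaw_le_fst.mono (hq ε))
    _ = 2 ^ d * (n * (n.choose k * q ^ k)) := by simp

lemma law_lt_cliqueNum_le (hn : n ≠ 0) (hd : d ≠ 0) (hlam : 0 ≤ lam) (hw₀ : 0 < w₀) (hβ : 3 ≤ β)
    (k : ℕ)
    (hnd : (lam * w₀ ^ 2 * 4 ^ d / n) ^ ((β - 1) / 2) ≤ 3 * (lam * w₀ ^ 2 / n) * (10 / 11) ^ d) :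
    law n d β w₀ {s | k < (graph lam s).cliqueNum} ≤ ENNReal.ofReal
      (2 ^ d * n * ((3 * lam * w₀ ^ 2 * (10 / 11) ^ d) ^ k / k.factorial)) := by
  set q := 3 * (lam * w₀ ^ 2 / n) * (10 / 11) ^ d with hq
  have hq₀ : 0 ≤ q := by positivity
  have hnq : n * q = 3 * lam * w₀ ^ 2 * (10 / 11) ^ d := by
    rw [hq]
    field_simp
  calc law n d β w₀ {s | k < (graph lam s).cliqueNum}
      ≤ 2 ^ d * (n * (n.choose k * ENNReal.ofReal q ^ k)) :=
        law_lt_cliqueNum_le_choose hlam hw₀ (by linarith) k fun ε _ hz =>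
          vertexLaw_cliqueRegion_le hn hd hlam hw₀ hβ ε hz hnd
    _ = ENNReal.ofReal (2 ^ d * (n * (n.choose k * q ^ k))) := by
        simp [ENNReal.ofReal_mul, ENNReal.ofReal_pow, hq₀]
    _ ≤ ENNReal.ofReal (2 ^ d * (n * (n ^ k / k.factorial * q ^ k))) := by
        gcongr
        exact Nat.choose_le_pow_div k n
    _ = _ := by
        rw [← hnq, mul_pow]
        congr 1
        ring

end VertexLaw

section Asymptotics

variable {L c a d : ℝ}

lemma one_half_le_div_add_log (hL : 0 < L) (hℓ : 0 < Real.log L) (hd : 0 ≤ d) (hdL : d ≤ L) :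
    1 / 2 ≤ L / (d + Real.log L) := by
  rw [div_le_div_iff₀ two_pos (by positivity)]
  linarith [Real.log_le_sub_one_of_pos hL]

lemma log_div_two_le_log_div_log (hL : 0 < L) (hℓ : 0 < Real.log L) :
    Real.log L / 2 ≤ Real.log (L / Real.log L) := by
  have hloglog : Real.log (Real.log L) ≤ Real.log L / 2 := by
    have hsplit : Real.log (Real.log L) = Real.log 2 + Real.log (Real.log L / 2) := by
      rw [← Real.log_mul two_ne_zero (by positivity), mul_div_cancel₀ _ two_ne_zero]
    linarith [Real.log_le_sub_one_of_pos (half_pos hℓ), Real.log_two_lt_d9]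
  rw [Real.log_div hL.ne' hℓ.ne']
  linarith

/-- If `d ≤ log L` then the term `log k` dominates, otherwise the term `c * d` does. -/
lemma mul_add_log_le_log_add {k : ℝ} (hL : 0 < L) (hℓ : 0 < Real.log L) (hc : 0 < c)
    (hc_half : c ≤ 1 / 2) (ha : 2 * a ≤ c * Real.log L) (hd : 0 ≤ d) (hdL : d ≤ L)
    (hk : 12 / c * (L / (d + Real.log L)) ≤ k) :
    c / 4 * (d + Real.log L) ≤ Real.log k + c * d - a := by
  have hk_two : 2 * (L / (d + Real.log L)) ≤ k := by
    refine le_trans ?_ hk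
    gcongr
    rw [le_div_iff₀ hc]
    linarith
  obtain hdℓ | hℓd := le_total d (Real.log L)
  · have hk_div : L / Real.log L ≤ k := by
      calc L / Real.log L = 2 * (L / (Real.log L + Real.log L)) := by field_simp; norm_num
        _ ≤ 2 * (L / (d + Real.log L)) := by gcongr
        _ ≤ k := hk_two
    have hlog : Real.log L / 2 ≤ Real.log k :=
      (log_div_two_le_log_div_log hL hℓ).trans (Real.log_le_log (by positivity) hk_div)
    nlinarith
  · have hk_one : 1 ≤ k := by linarith [one_half_le_div_add_log hL hℓ hd hdL]
    nlinarith [Real.log_nonneg hk_one]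

lemma three_mul_le_floor_mul (hL : 0 < L) (hℓ : 0 < Real.log L) (hc : 0 < c) (hc_half : c ≤ 1 / 2)
    (ha : 2 * a ≤ c * Real.log L) (hd : 0 ≤ d) (hdL : d ≤ L) {x : ℝ}
    (hx : x = 24 / c * (L / (d + Real.log L))) :
    1 ≤ ⌊x⌋₊ ∧ 3 * L ≤ ⌊x⌋₊ * (Real.log ⌊x⌋₊ + c * d - a) := by
  have hx_one : 1 ≤ x := by
    have hc_inv : 2 ≤ 24 / c := by
      rw [le_div_iff₀ hc]
      linarith
    rw [hx]
    nlinarith [one_half_le_div_add_log hL hℓ hd hdL]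
  have hx_half : x / 2 ≤ ⌊x⌋₊ := (Nat.div_two_lt_floor hx_one).le
  refine ⟨(Nat.one_le_floor_iff x).2 hx_one, ?_⟩
  have hlog : c / 4 * (d + Real.log L) ≤ Real.log ⌊x⌋₊ + c * d - a := by
    refine mul_add_log_le_log_add hL hℓ hc hc_half ha hd hdL (hx_half.trans' (le_of_eq ?_))
    rw [hx]
    ring
  calc 3 * L = x / 2 * (c / 4 * (d + Real.log L)) := by
        rw [hx]
        field_simp
        norm_num
    _ ≤ ⌊x⌋₊ * (Real.log ⌊x⌋₊ + c * d - a) := by gcongr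

lemma pow_div_factorial_le_exp_mul {k : ℕ} (ha : 0 < a) (hk : k ≠ 0) :
    a ^ k / k.factorial ≤ Real.exp (k * (Real.log a + 1 - Real.log k)) := by
  have hk₀ : (0 : ℝ) < k := by positivity
  calc a ^ k / k.factorial = (a / k) ^ k * ((k : ℝ) ^ k / k.factorial) := by
        rw [div_pow]
        field_simp
    _ ≤ (a / k) ^ k * Real.exp k := by
        gcongr
        exact Real.pow_div_factorial_le_exp k hk₀.le k
    _ = Real.exp (k * Real.log (a / k)) * Real.exp k := by
        rw [Real.exp_nat_mul, Real.exp_log (by positivity)]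
    _ = Real.exp (k * (Real.log a + 1 - Real.log k)) := by
        rw [← Real.exp_add, Real.log_div ha.ne' hk₀.ne']
        ring_nf

lemma two_pow_mul_pow_div_factorial_le_inv {n d k : ℕ} {A : ℝ} (hn : n ≠ 0) (hk : k ≠ 0)
    (hA : 0 < A) (hd : (d : ℝ) ≤ Real.log n)
    (h : 3 * Real.log n ≤ k * (Real.log k + Real.log (11 / 10) * d - (1 + Real.log A))) :
    2 ^ d * n * ((A * (10 / 11) ^ d) ^ k / k.factorial) ≤ (n : ℝ)⁻¹ := by
  have hn₀ : (0 : ℝ) < n := by positivity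
  have htwo : (2 : ℝ) ^ d ≤ n := by
    calc (2 : ℝ) ^ d ≤ Real.exp 1 ^ d := by
          gcongr
          linarith [Real.exp_one_gt_d9]
      _ = Real.exp d := by rw [← Real.exp_nat_mul, mul_one]
      _ ≤ n := (Real.le_log_iff_exp_le hn₀).1 hd
  have hlog : Real.log (A * (10 / 11) ^ d) = Real.log A - Real.log (11 / 10) * d := by
    rw [Real.log_mul hA.ne' (by positivity), Real.log_pow, ← inv_div 11 10, Real.log_inv]
    ring
  have hfactorial : (A * (10 / 11) ^ d) ^ k / k.factorial ≤ ((n : ℝ) ^ 3)⁻¹ := by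
    refine (pow_div_factorial_le_exp_mul (by positivity) hk).trans ?_
    rw [← Real.le_log_iff_exp_le (by positivity), Real.log_inv, Real.log_pow, hlog]
    push_cast
    linarith
  calc 2 ^ d * n * ((A * (10 / 11) ^ d) ^ k / k.factorial) ≤ n * n * ((n : ℝ) ^ 3)⁻¹ := by gcongr
    _ = (n : ℝ)⁻¹ := by field_simp

lemma tendsto_log_natCast_atTop : Tendsto (fun n : ℕ => Real.log n) atTop atTop :=
  Real.tendsto_log_atTop.comp tendsto_natCast_atTop_atTop

lemma exists_forall_eventually_rpow_le {p b ρ : ℝ} (hp : 1 < p) (hb : 1 < b) (hρ : 0 < ρ)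
    (hρ_one : ρ < 1) :
    ∃ ε : ℝ, 0 < ε ∧ ∀ a A : ℝ, 0 < a → 0 < A → ∀ᶠ n : ℕ in atTop, ∀ d : ℕ,
      (d : ℝ) ≤ ε * Real.log n → (a * b ^ d / n) ^ p ≤ A / n * ρ ^ d := by
  set K := p * Real.log b - Real.log ρ
  have hK : 0 < K := by
    have := Real.log_pos hb
    have := Real.log_neg hρ hρ_one
    have : 0 < p * Real.log b := by positivity
    linarith
  have hp_half : 0 < (p - 1) / 2 := by linarith
  refine ⟨(p - 1) / 2 / K, by positivity, fun a A ha hA => ?_⟩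
  filter_upwards [(tendsto_log_natCast_atTop.const_mul_atTop hp_half).eventually_ge_atTop
    (p * Real.log a - Real.log A), eventually_gt_atTop 0] with n hn_large hn d hd
  have hn₀ : (0 : ℝ) < n := by positivity
  have hdK : d * K ≤ (p - 1) / 2 * Real.log n := by
    rwa [div_mul_eq_mul_div, le_div_iff₀ hK] at hd
  have hlog_left : Real.log ((a * b ^ d / n) ^ p)
      = p * (Real.log a + d * Real.log b - Real.log n) := by
    rw [Real.log_rpow (by positivity), Real.log_div (by positivity) hn₀.ne',
      Real.log_mul ha.ne' (by positivity), Real.log_pow]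
  have hlog_right : Real.log (A / n * ρ ^ d)
      = Real.log A - Real.log n + d * Real.log ρ := by
    rw [Real.log_mul (by positivity) (by positivity), Real.log_div hA.ne' hn₀.ne', Real.log_pow]
  rw [← Real.log_le_log_iff (by positivity) (by positivity), hlog_left, hlog_right]
  simp only [K] at hdK
  linarith

lemma exists_forall_eventually_law_lt_cliqueNum_le_inv {β : ℝ} (hβ : 3 < β) :
    ∃ ε : ℝ, 0 < ε ∧ ∀ w₀ lam : ℝ, 0 < w₀ → 0 < lam → ∀ᶠ n : ℕ in atTop, ∀ d : ℕ, d ≠ 0 →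
      (d : ℝ) ≤ ε * Real.log n →
        law n d β w₀ {s | 24 / Real.log (11 / 10) * (Real.log n / (d + Real.log (Real.log n)))
          < (graph lam s).cliqueNum} ≤ ENNReal.ofReal (n : ℝ)⁻¹ := by
  set c := Real.log (11 / 10)
  have hc : 0 < c := Real.log_pos (by norm_num)
  have hc_half : c ≤ 1 / 2 :=
    (Real.log_le_sub_one_of_pos (by norm_num)).trans (by norm_num)
  obtain ⟨ε, hε, hrpow⟩ := exists_forall_eventually_rpow_le (p := (β - 1) / 2) (b := 4)
    (ρ := 10 / 11) (by linarith) (by norm_num) (by norm_num) (by norm_num)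
  refine ⟨min ε 1, by positivity, fun w₀ lam hw₀ hlam => ?_⟩
  set A := 3 * lam * w₀ ^ 2
  have hA : 0 < A := by positivity
  have hloglog := Real.tendsto_log_atTop.comp tendsto_log_natCast_atTop
  filter_upwards [hrpow (lam * w₀ ^ 2) A (by positivity) hA, eventually_ne_atTop 0,
    tendsto_log_natCast_atTop.eventually_gt_atTop 0, hloglog.eventually_gt_atTop 0,
    (hloglog.const_mul_atTop hc).eventually_ge_atTop (2 * (1 + Real.log A))]
    with n hrpow_n hn hL hℓ hℓA d hd hdε
  have hdL : (d : ℝ) ≤ Real.log n := hdε.trans (mul_le_of_le_one_left hL.le (min_le_right _ _))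
  have hnd : (lam * w₀ ^ 2 * 4 ^ d / n) ^ ((β - 1) / 2)
      ≤ 3 * (lam * w₀ ^ 2 / n) * (10 / 11) ^ d := by
    refine (hrpow_n d (hdε.trans (by gcongr; exact min_le_left _ _))).trans_eq ?_
    simp only [A]
    ring
  obtain ⟨hk, hbound⟩ := three_mul_le_floor_mul hL hℓ hc hc_half hℓA d.cast_nonneg hdL rfl
  set x := 24 / c * (Real.log n / (d + Real.log (Real.log n)))
  have hx : 0 ≤ x := (Nat.pos_of_floor_pos hk).le
  simp only [← Nat.floor_lt hx]
  exact (law_lt_cliqueNum_le hn hd hlam.le hw₀ hβ.le ⌊x⌋₊ hnd).trans (ENNReal.ofReal_le_ofReal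
    (two_pow_mul_pow_div_factorial_le_inv hn (Nat.one_le_iff_ne_zero.1 hk) hA hdL hbound))

lemma tendsto_measure_one_of_eventually_compl_le {ι : Type*} {l : Filter ι} {Ω : ι → Type*}
    [∀ i, MeasurableSpace (Ω i)] {μ : ∀ i, Measure (Ω i)} [∀ i, IsProbabilityMeasure (μ i)]
    {s : ∀ i, Set (Ω i)} {b : ι → ℝ≥0∞} (hb : Tendsto b l (𝓝 0))
    (hs : ∀ᶠ i in l, μ i (s i)ᶜ ≤ b i) : Tendsto (fun i => μ i (s i)) l (𝓝 1) := by
  have hlim : Tendsto (fun i => 1 - b i) l (𝓝 1) := by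
    simpa using ENNReal.Tendsto.sub tendsto_const_nhds hb (Or.inl ENNReal.one_ne_top)
  refine tendsto_of_tendsto_of_tendsto_of_le_of_le' hlim tendsto_const_nhds
    (hs.mono fun i hi => tsub_le_iff_right.2 ?_) (.of_forall fun i => prob_le_one)
  calc 1 = μ i Set.univ := measure_univ.symm
    _ ≤ μ i (s i) + μ i (s i)ᶜ := measure_univ_le_add_compl _
    _ ≤ μ i (s i) + b i := by gcongr

end Asymptotics

end GIRG

theorem mainTheorem11_general :
    ∃ C : ℝ, 0 < C ∧ ∀ β : ℝ, 3 < β → ∃ ε : ℝ, 0 < ε ∧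
      ∀ w₀ lam : ℝ, 0 < w₀ → 0 < lam → ∀ d : ℕ → ℕ, (∀ n, 1 ≤ d n) →
        (∀ᶠ n : ℕ in atTop, (d n : ℝ) ≤ ε * Real.log n) →
        Tendsto
          (fun n : ℕ => GIRG.law n (d n) β w₀
            {s | ((GIRG.graph lam s).cliqueNum : ℝ)
              ≤ C * (Real.log n / (d n + Real.log (Real.log n)))})
          atTop (𝓝 1) := by
  refine ⟨24 / Real.log (11 / 10), div_pos (by norm_num) (Real.log_pos (by norm_num)), ?_⟩
  intro β hβ
  obtain ⟨ε, hε, hlaw⟩ := GIRG.exists_forall_eventually_law_lt_cliqueNum_le_inv hβ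
  refine ⟨ε, hε, fun w₀ lam hw₀ hlam d hd_one hd => ?_⟩
  have (n : ℕ) := GIRG.isProbabilityMeasure_law (n := n) (d := d n) hw₀ (by linarith : 1 < β)
  have hinv : Tendsto (fun n : ℕ => ENNReal.ofReal (n : ℝ)⁻¹) atTop (𝓝 0) := by
    simpa using ENNReal.tendsto_ofReal (tendsto_inv_atTop_nhds_zero_nat (𝕜 := ℝ))
  refine GIRG.tendsto_measure_one_of_eventually_compl_le hinv ?_
  filter_upwards [hlaw w₀ lam hw₀ hlam, hd] with n hn hdn
  simpa only [Set.compl_ofPred, not_le] using hn (d n) (Nat.one_le_iff_ne_zero.1 (hd_one n)) hdn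

theorem mainTheorem11 (β w₀ lam : ℝ) (hβ : 3 < β) (hw₀ : 0 < w₀) (hlam : 0 < lam) :
    ∃ C : ℝ, 0 < C ∧
      ∀ d : ℕ → ℕ, (∀ n, 1 ≤ d n) →
        ((fun n : ℕ => (d n : ℝ)) =o[atTop] fun n : ℕ => Real.log n) →
        Tendsto
          (fun n : ℕ => GIRG.law n (d n) β w₀
            {s | ((GIRG.graph lam s).cliqueNum : ℝ)
              ≤ C * (Real.log n / (d n + Real.log (Real.log n)))})
          atTop (𝓝 1) := by
  obtain ⟨C, hC, h⟩ := mainTheorem11_general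
  obtain ⟨ε, hε, h⟩ := h β hβ
  refine ⟨C, hC, fun d hd_one hd => h w₀ lam hw₀ hlam d hd_one ((hd.def hε).mono fun n hn => ?_)⟩
  simpa [abs_of_nonneg (Real.log_natCast_nonneg n)] using hn
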